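/- Let $G$ be a partially ordered abelian group (i.e. an abelian group with a translation-invariant partial order $\le$), with positive cone $G^+=\{a\in G : 0\le a\}$, and write $\mathbb N=\{1,2,3,\dots\}$. Let $\mu\colon G\times G\to G$ be a biadditive binary operation (additive in each argument) such that $\mu(a,b)\in G^+$ for all $a,b\in G^+$. Assume that there is an element $e\in G^+$ with $\mu(e,a)=a=\mu(a,e)$ for all $a\in G$ (such an element is necessarily unique), and that $e$ is also an order-unit of $G$, i.e. for every $a\in G$ there is $k\in\mathbb N$ with $a\le ke$. Suppose that - $G$ is weakly archimedean: whenever $a,b\in G$ satisfy $-b\le \ell a\le b$ for all $\ell\in\mathbb N$, then $a=0$; and - the order is unperforated: for all $a,b\in G$ and $k\in\mathbb N$, $a\le b$ if and only if $ka\le kb$. Then $\mu$ is both associative and commutative. Moreover, under the assumptions of the first paragraph, both of these conditions hold if $G$ is archimedean (whenever $a,b\in G$ satisfy $0\le \ell a+b$ for all $\ell\in\mathbb N$, then $0\le a$); so in particular $\mu$ is associative and commutative if $G$ is archimedean. -/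

import Mathlib

namespace PoGroup

/-- A binary operation is biadditive if it is additive in each argument separately. -/
def IsBiadditive {G : Type*} [AddCommGroup G] (μ : G → G → G) : Prop :=
  (∀ a a' b : G, μ (a + a') b = μ a b + μ a' b) ∧
    ∀ a b b' : G, μ a (b + b') = μ a b + μ a b'

/-- The operation maps pairs of elements of the positive cone into the positive cone. -/
def IsPositivityPreserving {G : Type*} [AddCommGroup G] [PartialOrder G] (μ : G → G → G) : Prop :=
  ∀ a b : G, 0 ≤ a → 0 ≤ b → 0 ≤ μ a b

/-- `e` is a two-sided algebraic unit of `μ`. -/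
def IsTwoSidedUnit {G : Type*} (μ : G → G → G) (e : G) : Prop :=
  ∀ a : G, μ e a = a ∧ μ a e = a

/-- An order-unit is a positive element with some positive multiple above each given element. -/
def IsOrderUnit {G : Type*} [AddCommGroup G] [PartialOrder G] (e : G) : Prop :=
  0 ≤ e ∧ ∀ a : G, ∃ k : ℕ, 0 < k ∧ a ≤ k • e

/-- The order is unperforated. -/
def IsUnperforated (G : Type*) [AddCommGroup G] [PartialOrder G] : Prop :=
  ∀ (a b : G) (k : ℕ), 0 < k → (a ≤ b ↔ k • a ≤ k • b)

/-- Archimedean, in the sense used for partially ordered abelian groups. For partial orders this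
is not the same as Mathlib's class `Archimedean`. -/
def IsArchimedean (G : Type*) [AddCommGroup G] [PartialOrder G] : Prop :=
  ∀ a b : G, (∀ l : ℕ, 0 < l → 0 ≤ l • a + b) → 0 ≤ a

/-- Weakly archimedean partially ordered abelian groups. -/
def IsWeaklyArchimedean (G : Type*) [AddCommGroup G] [PartialOrder G] : Prop :=
  ∀ a b : G, (∀ l : ℕ, 0 < l → -b ≤ l • a ∧ l • a ≤ b) → a = 0

end PoGroup

/-!
A *state* is an additive map `φ : G → ℝ` that is nonnegative on the positive cone and satisfies
`φ e = 1`. Associativity and commutativity hold because `G` has enough states `φ` that are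
multiplicative, `φ (μ a b) = φ a * φ b`, to separate its points, and `ℝ` is an associative and
commutative ring.

* The states separate the points of `G` (`exists_state_ne_zero`). If `x ≠ 0`, the weak archimedean
  property gives, up to the sign of `x`, an `l > 0` such that `y = e + l • x` is not positive. As
  the order is unperforated, the cone generated by `G⁺` and `-y` contains no `-(k • e)` with
  `0 < k`, and by Zorn's lemma it lies in a maximal cone with this property. A maximal such cone
  `Q` is total (`mem_or_neg_mem_of_maximal`), and comparing the multiples of an element with those
  of `e` with respect to `Q` defines a state (`cut_mem_states`), which is negative at `x`.
* The states form a compact convex subset of `G → ℝ`, and its extreme points are multiplicative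
  (`map_mul_of_mem_extremePoints`): for `e ≤ d ≤ K • e - e`, the state `φ` is a proper convex
  combination of the states proportional to `a ↦ φ (μ a d)` and `a ↦ φ (μ a (K • e - d))`, so an
  extreme `φ` is equal to both.
* By the Krein–Milman theorem, an element killed by all extreme states is killed by all states and
  is therefore zero (`eq_zero_of_extremePoints`).
-/

namespace PoGroup

/-! ### Archimedean groups -/

section Archimedean

variable {G : Type*} [AddCommGroup G] [PartialOrder G] [IsOrderedAddMonoid G]

theorem IsArchimedean.isWeaklyArchimedean (h : IsArchimedean G) : IsWeaklyArchimedean G := by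
  intro a b hab
  apply le_antisymm
  · have := h (-a) b fun l hl => by
      have := (hab l hl).2
      rw [smul_neg, neg_add_eq_sub]
      exact sub_nonneg.2 this
    exact neg_nonneg.1 this
  · exact h a b fun l hl => neg_le_iff_add_nonneg.1 (hab l hl).1

/-- Finitely many elements have a common upper bound that is a multiple of the order-unit. -/
theorem IsOrderUnit.exists_nsmul_ge {e : G} (he : IsOrderUnit e) (f : ℕ → G) (n : ℕ) :
    ∃ m : ℕ, ∀ i < n, f i ≤ m • e := by
  induction n with
  | zero => exact ⟨0, fun i hi => absurd hi (Nat.not_lt_zero i)⟩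
  | succ n ih =>
    obtain ⟨m, hm⟩ := ih
    obtain ⟨k, -, hk⟩ := he.2 (f n)
    refine ⟨max m k, fun i hi => ?_⟩
    rcases Nat.lt_succ_iff_lt_or_eq.1 hi with hi | rfl
    · exact (hm i hi).trans (nsmul_le_nsmul_left he.1 (le_max_left _ _))
    · exact hk.trans (nsmul_le_nsmul_left he.1 (le_max_right _ _))

/-- If `0 ≤ k • a`, then division of `l` by `k` shows that `l • a` is bounded below by the
finitely many elements `r • a` with `r < k`. -/
theorem IsArchimedean.isUnperforated (h : IsArchimedean G) {e : G} (he : IsOrderUnit e) :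
    IsUnperforated G := by
  have key : ∀ (a : G) (k : ℕ), 0 < k → 0 ≤ k • a → 0 ≤ a := by
    intro a k hk hka
    obtain ⟨m, hm⟩ := he.exists_nsmul_ge (fun r => -(r • a)) k
    refine h a (m • e) fun l _ => ?_
    have h1 : l • a = (l / k) • (k • a) + (l % k) • a := by
      rw [← mul_nsmul, ← add_nsmul, Nat.div_add_mod]
    rw [h1, add_assoc]
    exact add_nonneg (nsmul_nonneg hka _)
      (neg_le_iff_add_nonneg'.1 (hm _ (Nat.mod_lt l hk)))
  intro a b k hk
  refine ⟨fun hab => nsmul_le_nsmul_right hab k, fun hab => ?_⟩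
  refine sub_nonneg.1 (key _ k hk ?_)
  rw [nsmul_sub]
  exact sub_nonneg.2 hab

end Archimedean

/-! ### States from total cones -/

section Cut

variable {G : Type*} [AddCommGroup G]

/-- The states of `G` with respect to `e`, as a subset of the space of all functions `G → ℝ`: the
additive functions that are nonnegative on the positive cone and take the value `1` at `e`. -/
def states [PartialOrder G] (e : G) : Set (G → ℝ) :=
  {φ | (∀ a b, φ (a + b) = φ a + φ b) ∧ (∀ a, 0 ≤ a → 0 ≤ φ a) ∧ φ e = 1}

/-- A cone avoiding the negative multiples of `e`, that is, one in which `e` is still strictly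
positive. -/
def IsProperCone (e : G) (Q : AddSubmonoid G) : Prop :=
  ∀ k : ℕ, 0 < k → -(k • e) ∉ Q

/-- The fractions `p / q` for which `p • e` lies below `q • a` with respect to the cone `Q`. -/
def lowerFractions (e : G) (Q : AddSubmonoid G) (a : G) : Set ℝ :=
  {r | ∃ (p : ℤ) (q : ℕ), 0 < q ∧ q • a - p • e ∈ Q ∧ r = p / q}

/-- The value of `a` measured in units of `e` with respect to the cone `Q`. -/
noncomputable def cut (e : G) (Q : AddSubmonoid G) (a : G) : ℝ :=
  sSup (lowerFractions e Q a)

/-- In a maximal proper cone, every element is comparable to zero: otherwise the cones obtained by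
adjoining `a` and `-a` contain negative multiples of `e`, and eliminating `a` yields one in `Q`. -/
theorem mem_or_neg_mem_of_maximal {e : G} {Q : AddSubmonoid G}
    (hQ : Maximal (IsProperCone e) Q) (a : G) : a ∈ Q ∨ -a ∈ Q := by
  have key : ∀ b : G, b ∉ Q → ∃ k n : ℕ, 0 < k ∧ ∃ q ∈ Q, q + n • b = -(k • e) := by
    intro b hb
    by_contra hcon
    have hprop : IsProperCone e (Q ⊔ AddSubmonoid.closure {b}) := by
      intro k hk hmem
      obtain ⟨q, hq, z, hz, hqz⟩ := AddSubmonoid.mem_sup.1 hmem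
      obtain ⟨n, rfl⟩ := AddSubmonoid.mem_closure_singleton.1 hz
      exact hcon ⟨k, n, hk, q, hq, hqz⟩
    exact hb (hQ.2 hprop le_sup_left
      (AddSubmonoid.mem_sup_right (AddSubmonoid.subset_closure rfl)))
  by_contra hcon
  push Not at hcon
  obtain ⟨k, n, hk, q, hq, h1⟩ := key a hcon.1
  obtain ⟨l, m, hl, q', hq', h2⟩ := key (-a) hcon.2
  rcases Nat.eq_zero_or_pos m with rfl | hm
  · rw [zero_nsmul, add_zero] at h2
    exact hQ.1 l hl (h2 ▸ hq')
  · refine hQ.1 (m * k + n * l) (by positivity) ?_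
    have : -((m * k + n * l) • e) = m • q + n • q' := by
      have e1 := congrArg (fun z => m • z) h1
      have e2 := congrArg (fun z => n • z) h2
      calc -((m * k + n * l) • e) = m • -(k • e) + n • -(l • e) := by module
        _ = m • q + n • q' := by rw [← e1, ← e2]; module
    rw [this]
    exact Q.add_mem (Q.nsmul_mem hq _) (Q.nsmul_mem hq' _)

theorem exists_maximal_properCone {e : G} {Q₀ : AddSubmonoid G} (h : IsProperCone e Q₀) :
    ∃ Q, Q₀ ≤ Q ∧ Maximal (IsProperCone e) Q := by
  refine zorn_le_nonempty₀ {Q | IsProperCone e Q} (fun c hc hchain Q hQ => ?_) Q₀ h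
  refine ⟨sSup c, fun k hk hmem => ?_, fun z hz => le_sSup hz⟩
  obtain ⟨s, hs, hks⟩ := (AddSubmonoid.mem_sSup_of_directedOn ⟨Q, hQ⟩ hchain.directedOn).1 hmem
  exact hc hs k hk hks

variable {e : G} {Q : AddSubmonoid G}

theorem IsProperCone.nonneg_of_zsmul_mem (hQ : IsProperCone e Q) {z : ℤ} (hz : z • e ∈ Q) :
    0 ≤ z := by
  by_contra hneg
  push Not at hneg
  refine hQ z.natAbs (by omega) ?_
  have : -(z.natAbs • e) = z • e := by
    rw [← natCast_zsmul, ← neg_zsmul]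
    congr 1
    omega
  rwa [this]

/-- A lower fraction of `a` is at most every upper fraction of `a`. -/
theorem le_of_mem_lowerFractions (hQ : IsProperCone e Q) {a : G} {p : ℤ} {q : ℕ} (hq : 0 < q)
    (h : p • e - q • a ∈ Q) {r : ℝ} (hr : r ∈ lowerFractions e Q a) : r ≤ p / q := by
  obtain ⟨p', q', hq', h', rfl⟩ := hr
  have hmem : (q' * p - q * p' : ℤ) • e ∈ Q := by
    have : (q' * p - q * p' : ℤ) • e = q • (q' • a - p' • e) + q' • (p • e - q • a) := by
      module
    rw [this]
    exact Q.add_mem (Q.nsmul_mem h' _) (Q.nsmul_mem h _)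
  have h0 : (0 : ℤ) ≤ q' * p - q * p' := hQ.nonneg_of_zsmul_mem hmem
  rw [div_le_div_iff₀ (by positivity) (by positivity)]
  have h1 : ((q : ℤ) * p' : ℤ) ≤ q' * p := by linarith
  have h2 : ((q : ℝ) * p') ≤ q' * p := by exact_mod_cast h1
  linarith

variable (hunit : ∀ a : G, ∃ k : ℕ, k • e - a ∈ Q)

include hunit

theorem lowerFractions_nonempty (a : G) : (lowerFractions e Q a).Nonempty := by
  obtain ⟨k, hk⟩ := hunit (-a)
  refine ⟨_, -(k : ℤ), 1, one_pos, ?_, rfl⟩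
  convert hk using 1
  module

theorem bddAbove_lowerFractions (hQ : IsProperCone e Q) (a : G) :
    BddAbove (lowerFractions e Q a) := by
  obtain ⟨k, hk⟩ := hunit a
  refine ⟨((k : ℤ) : ℝ) / (1 : ℕ), fun r hr => le_of_mem_lowerFractions hQ one_pos ?_ hr⟩
  convert hk using 1
  module

theorem le_cut (hQ : IsProperCone e Q) {a : G} {p : ℤ} {q : ℕ} (hq : 0 < q)
    (h : q • a - p • e ∈ Q) : (p : ℝ) / q ≤ cut e Q a :=
  le_csSup (bddAbove_lowerFractions hunit hQ a) ⟨p, q, hq, h, rfl⟩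

theorem cut_le (hQ : IsProperCone e Q) {a : G} {p : ℤ} {q : ℕ} (hq : 0 < q)
    (h : p • e - q • a ∈ Q) : cut e Q a ≤ p / q :=
  csSup_le (lowerFractions_nonempty hunit a) fun _ hr => le_of_mem_lowerFractions hQ hq h hr

theorem cut_add_cut_le (hQ : IsProperCone e Q) (a b : G) :
    cut e Q a + cut e Q b ≤ cut e Q (a + b) := by
  rw [cut, cut, ← csSup_add (lowerFractions_nonempty hunit a) (bddAbove_lowerFractions hunit hQ a)
    (lowerFractions_nonempty hunit b) (bddAbove_lowerFractions hunit hQ b)]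
  refine csSup_le ((lowerFractions_nonempty hunit a).add (lowerFractions_nonempty hunit b)) ?_
  rintro _ ⟨_, ⟨p, q, hq, h, rfl⟩, _, ⟨p', q', hq', h', rfl⟩, rfl⟩
  have hle : ((q' * p + q * p' : ℤ) : ℝ) / (q * q' : ℕ) ≤ cut e Q (a + b) := by
    refine le_cut hunit hQ (by positivity) ?_
    have : (q * q') • (a + b) - (q' * p + q * p' : ℤ) • e
        = q' • (q • a - p • e) + q • (q' • b - p' • e) := by module
    rw [this]
    exact Q.add_mem (Q.nsmul_mem h _) (Q.nsmul_mem h' _)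
  refine le_trans (le_of_eq ?_) hle
  push_cast
  field_simp

/-- With respect to a total cone, every multiple `n • a` lies between consecutive multiples of
`e`, so the lower fractions of `a` and of `-a` sum up to at least `-1 / n`. -/
theorem neg_inv_le_cut_add_cut_neg (hQ : IsProperCone e Q) (htot : ∀ a, a ∈ Q ∨ -a ∈ Q) (a : G)
    {n : ℕ} (hn : 0 < n) : -(1 / (n : ℝ)) ≤ cut e Q a + cut e Q (-a) := by
  obtain ⟨p, hp, hmax⟩ := Int.exists_greatest_of_bdd (P := fun p : ℤ => n • a - p • e ∈ Q)
    (by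
      obtain ⟨k, hk⟩ := hunit (n • a)
      refine ⟨k, fun z hz => ?_⟩
      have : ((k : ℤ) - z) • e ∈ Q := by
        convert Q.add_mem hk hz using 1
        module
      have := hQ.nonneg_of_zsmul_mem this
      linarith)
    (by
      obtain ⟨k, hk⟩ := hunit (-(n • a))
      refine ⟨-(k : ℤ), ?_⟩
      convert hk using 1
      module)
  have hp1 : n • -a - (-(p + 1)) • e ∈ Q := by
    have : n • a - (p + 1) • e ∉ Q := fun h => by
      have := hmax _ h
      omega
    convert (htot _).resolve_left this using 1
    module
  have h1 := le_cut hunit hQ hn hp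
  have h2 := le_cut hunit hQ hn hp1
  refine le_trans (le_of_eq ?_) (add_le_add h1 h2)
  push_cast
  field_simp
  ring

theorem cut_add (hQ : IsProperCone e Q) (htot : ∀ a, a ∈ Q ∨ -a ∈ Q) (a b : G) :
    cut e Q (a + b) = cut e Q a + cut e Q b := by
  refine le_antisymm ?_ (cut_add_cut_le hunit hQ a b)
  have h1 := cut_add_cut_le hunit hQ (a + b) (-b)
  rw [add_neg_cancel_right] at h1
  have h2 : 0 ≤ cut e Q b + cut e Q (-b) := by
    by_contra hneg
    push Not at hneg
    obtain ⟨n, hn⟩ := exists_nat_one_div_lt (neg_pos.2 hneg)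
    have := neg_inv_le_cut_add_cut_neg hunit hQ htot b n.succ_pos
    push_cast at this
    linarith
  linarith

theorem cut_nonneg (hQ : IsProperCone e Q) {a : G} (ha : a ∈ Q) : 0 ≤ cut e Q a := by
  have : ((0 : ℤ) : ℝ) / (1 : ℕ) ≤ cut e Q a := by
    refine le_cut hunit hQ one_pos ?_
    simpa using ha
  simpa using this

theorem cut_unit (hQ : IsProperCone e Q) : cut e Q e = 1 := by
  have h1 : ((1 : ℤ) : ℝ) / (1 : ℕ) ≤ cut e Q e := le_cut hunit hQ one_pos (by simp)
  have h2 : cut e Q e ≤ ((1 : ℤ) : ℝ) / (1 : ℕ) := cut_le hunit hQ one_pos (by simp)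
  simp only [Int.cast_one, Nat.cast_one, div_one] at h1 h2
  exact le_antisymm h2 h1

omit hunit in
theorem cut_mem_states [PartialOrder G] [IsOrderedAddMonoid G] (he : IsOrderUnit e)
    (hQ : IsProperCone e Q) (hnonneg : ∀ a, 0 ≤ a → a ∈ Q) (htot : ∀ a, a ∈ Q ∨ -a ∈ Q) :
    cut e Q ∈ states e ∧ ∀ a ∈ Q, 0 ≤ cut e Q a := by
  have hunit : ∀ a : G, ∃ k : ℕ, k • e - a ∈ Q := fun a => by
    obtain ⟨k, -, hk⟩ := he.2 a
    exact ⟨k, hnonneg _ (sub_nonneg.2 hk)⟩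
  exact ⟨⟨cut_add hunit hQ htot, fun a ha => cut_nonneg hunit hQ (hnonneg a ha),
    cut_unit hunit hQ⟩, fun a ha => cut_nonneg hunit hQ ha⟩

end Cut

/-! ### The state space -/

section States

variable {G : Type*} [AddCommGroup G] [PartialOrder G] {e : G} {φ : G → ℝ}

theorem map_zero_of_mem_states (hφ : φ ∈ states e) : φ 0 = 0 := by
  have := hφ.1 0 0
  rw [add_zero] at this
  linarith

theorem map_neg_of_mem_states (hφ : φ ∈ states e) (a : G) : φ (-a) = -φ a := by
  have := hφ.1 a (-a)
  rw [add_neg_cancel, map_zero_of_mem_states hφ] at this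
  linarith

theorem map_sub_of_mem_states (hφ : φ ∈ states e) (a b : G) : φ (a - b) = φ a - φ b := by
  rw [sub_eq_add_neg, hφ.1, map_neg_of_mem_states hφ, sub_eq_add_neg]

theorem map_nsmul_of_mem_states (hφ : φ ∈ states e) (n : ℕ) (a : G) : φ (n • a) = n * φ a := by
  induction n with
  | zero => simp [map_zero_of_mem_states hφ]
  | succ n ih => rw [succ_nsmul, hφ.1, ih]; push_cast; ring

theorem convex_states (e : G) : Convex ℝ (states e) := by
  rintro φ ⟨h1, h2, h3⟩ ψ ⟨k1, k2, k3⟩ s t hs ht hst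
  refine ⟨fun a b => ?_, fun a ha => ?_, ?_⟩
  · simp only [Pi.add_apply, Pi.smul_apply, smul_eq_mul, h1, k1]
    ring
  · simp only [Pi.add_apply, Pi.smul_apply, smul_eq_mul]
    exact add_nonneg (mul_nonneg hs (h2 a ha)) (mul_nonneg ht (k2 a ha))
  · simp only [Pi.add_apply, Pi.smul_apply, smul_eq_mul, h3, k3]
    linarith

variable [IsOrderedAddMonoid G]

theorem map_mono_of_mem_states (hφ : φ ∈ states e) {a b : G} (hab : a ≤ b) : φ a ≤ φ b := by
  have := hφ.2.1 _ (sub_nonneg.2 hab)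
  rw [map_sub_of_mem_states hφ] at this
  linarith

theorem isCompact_states (he : IsOrderUnit e) : IsCompact (states e) := by
  choose k _ hk using he.2
  have hbox : IsCompact (Set.univ.pi fun a : G => Set.Icc (-(k (-a) : ℝ)) (k a)) :=
    isCompact_univ_pi fun _ => isCompact_Icc
  refine hbox.of_isClosed_subset ?_ fun φ hφ a _ => ?_
  · have h : states e = (⋂ (a : G) (b : G), {φ : G → ℝ | φ (a + b) = φ a + φ b}) ∩
        ((⋂ (a : G) (_ : 0 ≤ a), {φ : G → ℝ | 0 ≤ φ a}) ∩ {φ : G → ℝ | φ e = 1}) := by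
      ext φ
      simp [states]
    rw [h]
    refine IsClosed.inter (isClosed_iInter fun a => isClosed_iInter fun b => ?_)
      (IsClosed.inter (isClosed_iInter fun a => isClosed_iInter fun _ => ?_) ?_)
    · exact isClosed_eq (by fun_prop) (by fun_prop)
    · exact isClosed_le (by fun_prop) (by fun_prop)
    · exact isClosed_eq (by fun_prop) (by fun_prop)
  · have hle : ∀ b, φ b ≤ k b := fun b => by
      have := map_mono_of_mem_states hφ (hk b)
      rwa [map_nsmul_of_mem_states hφ, hφ.2.2, mul_one] at this
    have := hle (-a)
    rw [map_neg_of_mem_states hφ] at this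
    exact ⟨by linarith, hle a⟩

/-- An element outside the positive cone is separated from it by a state: `G⁺` and `-y` lie in a
common total cone. A strict inequality cannot be expected, as `n • y + e` may be positive for
all `n`. -/
theorem exists_state_nonpos (he : IsOrderUnit e) (hunp : IsUnperforated G) {y : G}
    (hy : ¬ 0 ≤ y) : ∃ φ ∈ states e, φ y ≤ 0 := by
  have he0 : ¬ e ≤ 0 := fun h => hy <| by
    obtain ⟨k, -, hk⟩ := he.2 (-y)
    exact neg_nonpos.1 (hk.trans (nsmul_nonpos h k))
  have hprop : IsProperCone e (AddSubmonoid.nonneg G ⊔ AddSubmonoid.closure {-y}) := by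
    intro k hk hmem
    obtain ⟨g, hg, z, hz, hgz⟩ := AddSubmonoid.mem_sup.1 hmem
    obtain ⟨n, rfl⟩ := AddSubmonoid.mem_closure_singleton.1 hz
    have hg0 : 0 ≤ g := hg
    have hny : n • y = g + k • e := by
      rw [smul_neg, ← sub_eq_add_neg, sub_eq_iff_eq_add] at hgz
      rw [hgz]
      abel
    rcases Nat.eq_zero_or_pos n with rfl | hn
    · refine he0 ((hunp e 0 k hk).2 ?_)
      rw [smul_zero, ← zero_nsmul y, hny]
      exact le_add_of_nonneg_left hg0
    · refine hy ((hunp 0 y n hn).2 ?_)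
      rw [smul_zero, hny]
      exact add_nonneg hg0 (nsmul_nonneg he.1 k)
  obtain ⟨Q, hQ₀, hQ⟩ := exists_maximal_properCone hprop
  obtain ⟨hφ, hpos⟩ := cut_mem_states he hQ.1
    (fun a ha => hQ₀ (AddSubmonoid.mem_sup_left ha)) (mem_or_neg_mem_of_maximal hQ)
  refine ⟨_, hφ, ?_⟩
  have := hpos (-y) (hQ₀ (AddSubmonoid.mem_sup_right (AddSubmonoid.subset_closure rfl)))
  rw [map_neg_of_mem_states hφ] at this
  linarith

/-- In a weakly archimedean, unperforated group the states separate points. -/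
theorem exists_state_ne_zero (he : IsOrderUnit e) (hw : IsWeaklyArchimedean G)
    (hunp : IsUnperforated G) {x : G} (hx : x ≠ 0) : ∃ φ ∈ states e, φ x ≠ 0 := by
  have key : ∀ (z : G) (l : ℕ), ¬ -e ≤ l • z → ∃ φ ∈ states e, φ z ≠ 0 := by
    intro z l hl
    obtain ⟨φ, hφ, hφy⟩ := exists_state_nonpos he hunp
      (y := l • z + e) (fun h => hl (neg_le_iff_add_nonneg.2 h))
    refine ⟨φ, hφ, fun h0 => ?_⟩
    rw [hφ.1, map_nsmul_of_mem_states hφ, h0, hφ.2.2] at hφy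
    norm_num at hφy
  by_contra hcon
  refine hx (hw x e fun l _ => ⟨?_, ?_⟩)
  · by_contra hl
    exact hcon (key x l hl)
  · by_contra hl
    obtain ⟨φ, hφ, h⟩ := key (-x) l (by rwa [smul_neg, neg_le_neg_iff])
    rw [map_neg_of_mem_states hφ] at h
    exact hcon ⟨φ, hφ, neg_ne_zero.1 h⟩

/-- By the Krein–Milman theorem, the extreme states already separate points. -/
theorem eq_zero_of_extremePoints (he : IsOrderUnit e) (hw : IsWeaklyArchimedean G)
    (hunp : IsUnperforated G) {x : G} (h : ∀ φ ∈ (states e).extremePoints ℝ, φ x = 0) :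
    x = 0 := by
  by_contra hx
  obtain ⟨φ, hφ, hne⟩ := exists_state_ne_zero he hw hunp hx
  rw [← closure_convexHull_extremePoints (isCompact_states he) (convex_states e)] at hφ
  have hclosed : IsClosed {ψ : G → ℝ | ψ x = 0} := isClosed_eq (by fun_prop) (by fun_prop)
  have hconv : Convex ℝ {ψ : G → ℝ | ψ x = 0} := by
    intro ψ hψ χ hχ s t _ _ _
    simp only [Set.mem_ofPred_eq] at hψ hχ
    simp [hψ, hχ]
  exact hne (closure_minimal (convexHull_min h hconv) hclosed hφ)

/-! ### Extreme states are multiplicative -/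

variable {μ : G → G → G}

omit [IsOrderedAddMonoid G] in
/-- Multiplication by a positive element on which a state does not vanish, followed by
normalization, turns the state into another one. -/
theorem map_mul_div_mem_states (hadd : IsBiadditive μ) (hpos : IsPositivityPreserving μ)
    (hunit : IsTwoSidedUnit μ e) (hφ : φ ∈ states e) {d : G} (hd : 0 ≤ d) (hφd : 0 < φ d) :
    (fun a => φ (μ a d) / φ d) ∈ states e := by
  refine ⟨fun a b => ?_, fun a ha => ?_, ?_⟩
  · simp only [hadd.1, hφ.1, add_div]
  · exact div_nonneg (hφ.2.1 _ (hpos a d ha hd)) hφd.le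
  · simp only [(hunit d).1]
    exact div_self hφd.ne'

/-- If positive elements `d` and `d'` with `d + d' = K • e` both have positive value under a state,
then the state is a proper convex combination of its rescalings by `d` and `d'`; when it is extreme
it coincides with them. -/
theorem map_mul_of_add_eq_nsmul (hadd : IsBiadditive μ) (hpos : IsPositivityPreserving μ)
    (hunit : IsTwoSidedUnit μ e) (hφ : φ ∈ (states e).extremePoints ℝ) {d d' : G}
    (hd : 0 ≤ d) (hd' : 0 ≤ d') (hφd : 0 < φ d) (hφd' : 0 < φ d') {K : ℕ}
    (hK : d + d' = K • e) (a : G) : φ (μ a d) = φ a * φ d := by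
  have hS := hφ.1
  have h1 := map_mul_div_mem_states hadd hpos hunit hS hd hφd
  have h2 := map_mul_div_mem_states hadd hpos hunit hS hd' hφd'
  have hφK : φ d + φ d' = K := by
    rw [← hS.1, hK, map_nsmul_of_mem_states hS, hS.2.2, mul_one]
  have hKpos : (0 : ℝ) < K := by linarith
  have hmul : ∀ b, φ (μ b d) + φ (μ b d') = K * φ b := fun b => by
    have hn : ∀ n : ℕ, φ (μ b (n • e)) = n * φ b := by
      intro n
      induction n with
      | zero =>
        have h0 := hadd.2 b 0 0
        rw [add_zero, left_eq_add] at h0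
        simp [h0, map_zero_of_mem_states hS]
      | succ n ih =>
        rw [succ_nsmul, hadd.2, hS.1, ih, (hunit b).2]
        push_cast
        ring
    rw [← hS.1, ← hadd.2, hK, hn]
  have hseg : φ ∈ openSegment ℝ (fun b => φ (μ b d) / φ d) (fun b => φ (μ b d') / φ d') := by
    refine ⟨φ d / K, φ d' / K, by positivity, by positivity, ?_, ?_⟩
    · rw [← add_div, hφK, div_self hKpos.ne']
    · funext b
      simp only [Pi.add_apply, Pi.smul_apply, smul_eq_mul]
      have := hmul b
      field_simp
      linarith
  have heq := congrFun (hφ.2 h1 h2 hseg) a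
  rwa [div_eq_iff hφd.ne'] at heq

theorem map_mul_of_mem_extremePoints (hadd : IsBiadditive μ) (hpos : IsPositivityPreserving μ)
    (hunit : IsTwoSidedUnit μ e) (he : IsOrderUnit e) (hφ : φ ∈ (states e).extremePoints ℝ)
    (a b : G) : φ (μ a b) = φ a * φ b := by
  have hS := hφ.1
  obtain ⟨m, hm0, hm⟩ := he.2 (-b)
  obtain ⟨n, hn0, hn⟩ := he.2 b
  -- Both `c = m • e + e` and `c + b` are bounded below by `e`, so they are positive and have
  -- positive values, and so do their complements in a large multiple of `e`.
  have hφe : ∀ {d : G}, e ≤ d → 0 ≤ d ∧ 0 < φ d := fun {d} hd => by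
    have := map_mono_of_mem_states hS hd
    rw [hS.2.2] at this
    exact ⟨he.1.trans hd, by linarith⟩
  have hc : e ≤ m • e + e := le_add_of_nonneg_left (nsmul_nonneg he.1 m)
  have hcb : e ≤ (m • e + b) + e := le_add_of_nonneg_left (by
    rw [add_comm]; exact neg_le_iff_add_nonneg'.1 hm)
  have hnb : e ≤ (n • e - b) + e := le_add_of_nonneg_left (sub_nonneg.2 hn)
  have h1 := map_mul_of_add_eq_nsmul hadd hpos hunit hφ (hφe hcb).1 (hφe hnb).1 (hφe hcb).2
    (hφe hnb).2 (K := m + n + 2) (by module) a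
  have h2 := map_mul_of_add_eq_nsmul hadd hpos hunit hφ (hφe hc).1 (hφe hc).1 (hφe hc).2
    (hφe hc).2 (K := m + m + 2) (by module) a
  have hsplit : (m • e + b) + e = (m • e + e) + b := by abel
  rw [hsplit, hadd.2, hS.1, hS.1, h2] at h1
  linarith

end States

end PoGroup

theorem mainTheorem4 {G : Type*} [AddCommGroup G] [PartialOrder G] [IsOrderedAddMonoid G]
    (μ : G → G → G) (hadd : PoGroup.IsBiadditive μ) (hpos : PoGroup.IsPositivityPreserving μ)
    (e : G) (hunit : PoGroup.IsTwoSidedUnit μ e) (horder : PoGroup.IsOrderUnit e) :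
    (∀ e' : G, PoGroup.IsTwoSidedUnit μ e' → e' = e) ∧
    (PoGroup.IsArchimedean G → PoGroup.IsWeaklyArchimedean G ∧ PoGroup.IsUnperforated G) ∧
    (PoGroup.IsWeaklyArchimedean G → PoGroup.IsUnperforated G →
      (∀ a b c : G, μ (μ a b) c = μ a (μ b c)) ∧ (∀ a b : G, μ a b = μ b a)) := by
  refine ⟨fun e' he' => ?_, fun h => ⟨h.isWeaklyArchimedean, h.isUnperforated horder⟩,
    fun hw hunp => ?_⟩
  · rw [← (hunit e').1, (he' e).2]
  · have ext_states : ∀ x y : G,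
        (∀ φ ∈ (PoGroup.states e).extremePoints ℝ, φ x = φ y) → x = y := fun x y h =>
      sub_eq_zero.1 <| PoGroup.eq_zero_of_extremePoints horder hw hunp fun φ hφ => by
        rw [PoGroup.map_sub_of_mem_states hφ.1, h φ hφ, sub_self]
    have hmul := fun φ hφ =>
      PoGroup.map_mul_of_mem_extremePoints (φ := φ) hadd hpos hunit horder hφ
    refine ⟨fun a b c => ext_states _ _ fun φ hφ => ?_, fun a b => ext_states _ _ fun φ hφ => ?_⟩
    · simp only [hmul φ hφ, mul_assoc]
    · rw [hmul φ hφ, hmul φ hφ, mul_comm]
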